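/- Let $m\ge 1$ be an integer. Equip $(\mathbb C^2)^{\otimes m}$ with the standard Hermitian inner product, for which the tensors $e_{i_1}\otimes\cdots\otimes e_{i_m}$ form an orthonormal basis ($e_1,e_2$ being the standard basis of $\mathbb C^2$), and for $T\in(\mathbb C^2)^{\otimes m}$ let $$\|T\|_\sigma=\max\{|\langle T,u\rangle| : u=v_1\otimes\cdots\otimes v_m,\ v_1,\dots,v_m\in\mathbb C^2,\ \|u\|=1\}$$ be its spectral norm. For a tensor $T$ of norm $1$ let $E(T)=-2\log_2\|T\|_\sigma$ be its geometric measure of entanglement. Let $S^m_1(\mathbb C^2)$ be the set of all $T\in(\mathbb C^2)^{\otimes m}$ with $\|T\|=1$ that are invariant under all permutations of the $m$ tensor factors. Then the maximum $E^s_{\max}=\max\{E(T) : T\in S^m_1(\mathbb C^2)\}$ exists, and $$E^s_{\max}\ \ge\ \log_2 m-\log_2\bigl(1+\ln(4m\sqrt m)\bigr).$$ -/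

import Mathlib

namespace SymEntanglement

noncomputable section

/-- The Hilbert space `(ℂⁿ)^{⊗k}`, in coordinates: the tensor `T` has the coordinate `T i` at the
standard basis tensor `e_{i 0} ⊗ ⋯ ⊗ e_{i (k-1)}`, and these basis tensors are orthonormal. -/
abbrev Tensors (n k : ℕ) : Type := EuclideanSpace ℂ (Fin k → Fin n)

/-- The tensor `v₀ ⊗ ⋯ ⊗ v_{k-1}`. -/
def tprod {n k : ℕ} (v : Fin k → EuclideanSpace ℂ (Fin n)) : Tensors n k :=
  WithLp.toLp 2 fun i => ∏ j, v j (i j)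

/-- A tensor is pure if it is of the form `v₀ ⊗ ⋯ ⊗ v_{k-1}`. -/
def IsPure {n k : ℕ} (u : Tensors n k) : Prop :=
  ∃ v : Fin k → EuclideanSpace ℂ (Fin n), u = tprod v

/-- The spectral norm: the maximal value of `|⟨T, u⟩|` over the pure tensors `u` of norm one. -/
def specNorm {n k : ℕ} (T : Tensors n k) : ℝ :=
  sSup {x : ℝ | ∃ u : Tensors n k, IsPure u ∧ ‖u‖ = 1 ∧ x = ‖inner ℂ T u‖}

/-- The geometric measure of entanglement `E(T) = -2 log₂ ‖T‖_σ` (used for unit tensors). -/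
def entanglement {n k : ℕ} (T : Tensors n k) : ℝ :=
  -2 * Real.logb 2 (specNorm T)

/-- The action of a permutation of the tensor factors. -/
def permute {n m : ℕ} (σ : Equiv.Perm (Fin m)) (T : Tensors n m) : Tensors n m :=
  WithLp.toLp 2 fun i => T (i ∘ σ)

/-- The unit vectors of the space `Sᵐ(ℂⁿ)` of symmetric tensors. -/
def unitSym (n m : ℕ) : Set (Tensors n m) :=
  {T | (∀ σ : Equiv.Perm (Fin m), permute σ T = T) ∧ ‖T‖ = 1}

/-- The maximal entanglement of a symmetric tensor of norm one. -/
def maxSymEntanglement (n m : ℕ) : ℝ :=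
  sSup (entanglement '' unitSym n m)

end

end SymEntanglement

/-! A symmetric tensor in (ℂ²)^{⊗m} is a binary form f of degree m, and its norm is the Bombieri
norm of f. By Banach's theorem (`norm_symm_multilinear_le`) its spectral norm is the maximum of |f|
on the unit sphere of ℂ². It therefore suffices to find a form of Bombieri norm one that is
uniformly small on that sphere, and a Gaussian average supplies one.

For every p, the power f^p has degree mp, and Cauchy–Schwarz bounds |f(x,y)|^{2p} on the sphere by
‖f^p‖² in the Bombieri norm (`norm_binaryForm_pow_le`); no covering argument is needed. If the
coefficients d of f in the Bombieri-orthonormal basis are independent standard complex Gaussians,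
Wick's formula gives E‖f^p‖² = p!(mp+1) and E‖f‖^{2p} = (m+1)⋯(m+p). Comparing the two means, some f
of norm one satisfies max|f|^{2p} ≤ p!(mp+1)/((m+1)⋯(m+p)) (`exists_binaryForm_bound`).

Put L = 1 + ln(4m√m). It remains to choose p so that the right side is at most (L/m)^p. The choice p
= ⌊L⌋ works once L ≥ 8, that is for m ≥ 43; p = 4 serves for 5 ≤ m ≤ 42. For m ≤ 4 the claim follows
from ‖T‖_σ ≤ 1. The maximum exists because E is continuous on the compact set of symmetric unit
tensors. -/

/-! ### Banach's theorem on symmetric multilinear forms -/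

open Finset in
/-- Banach's theorem: a symmetric multilinear form on a finite-dimensional complex inner product
space takes its maximal modulus on unit vectors at a constant tuple. -/
theorem norm_symm_multilinear_le {ι E : Type*} [Fintype ι] [Nonempty ι]
    [NormedAddCommGroup E] [InnerProductSpace ℂ E] [FiniteDimensional ℂ E]
    (F : MultilinearMap ℂ (fun _ : ι => E) ℂ) (hF : Continuous F)
    (hsymm : ∀ (σ : Equiv.Perm ι) (v : ι → E), F (v ∘ σ) = F v) {M : ℝ}
    (hM : ∀ x : E, ‖x‖ = 1 → ‖F fun _ => x‖ ≤ M) (u : ι → E) (hu : ∀ i, ‖u i‖ = 1) :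
    ‖F u‖ ≤ M := by
  classical
  have : ProperSpace E := FiniteDimensional.proper ℂ E
  have hK : IsCompact {v : ι → E | ∀ i, ‖v i‖ = 1} := by
    have h := isCompact_univ_pi (fun _ : ι => isCompact_sphere (0 : E) 1)
    convert h using 1
    ext v
    simp
  obtain ⟨v₀, hv₀, hmax₀⟩ := hK.exists_isMaxOn ⟨u, hu⟩ (hF.norm.continuousOn)
  have hmax : ∀ v : ι → E, (∀ i, ‖v i‖ = 1) → ‖F v‖ ≤ ‖F v₀‖ := fun v hv => hmax₀ hv
  generalize hA : ‖F v₀‖ = A at hmax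
  have hK' : IsCompact ({v : ι → E | ∀ i, ‖v i‖ = 1} ∩ {v | ‖F v‖ = A}) :=
    hK.inter_right (isClosed_eq hF.norm continuous_const)
  -- Among all maximisers of |F|, one with the longest sum is selected; such a maximiser turns out
  -- to be constant. If two entries x ≠ y remained, replacing both by the normalised x + y would
  -- lengthen the sum.
  have hsum : Continuous fun v : ι → E => ‖∑ i, v i‖ := by fun_prop
  obtain ⟨v, ⟨hv, hvA⟩, hvmax₀⟩ := hK'.exists_isMaxOn ⟨v₀, hv₀, hA⟩ hsum.continuousOn
  simp only [Set.mem_ofPred_eq] at hv hvA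
  have hvmax : ∀ w : ι → E, (∀ i, ‖w i‖ = 1) → ‖F w‖ = A → ‖∑ i, w i‖ ≤ ‖∑ i, v i‖ :=
    fun w h1 h2 => hvmax₀ ⟨h1, h2⟩
  have hA0 : 0 ≤ A := hA ▸ norm_nonneg _
  have key : ∀ i j, v i = v j := by
    intro i j
    by_contra hne
    have hij : i ≠ j := fun h => hne (h ▸ rfl)
    set x := v i with hx
    set y := v j with hy
    set B : E → E → ℂ := fun a b => F (Function.update (Function.update v i a) j b) with hB
    have Bxy : B x y = F v := by simp [hB, hx, hy]
    have Bsymm : ∀ a b, B a b = B b a := by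
      intro a b
      simp only [hB]
      rw [← hsymm (Equiv.swap i j)]
      congr 1
      ext k
      simp only [Function.comp, Function.update_apply]
      rcases eq_or_ne k i with rfl | hki
      · simp [hij]
      · rcases eq_or_ne k j with rfl | hkj
        · simp [hij]
        · simp [Equiv.swap_apply_of_ne_of_ne hki hkj, hki, hkj]
    have Badd : ∀ a b c, B a (b + c) = B a b + B a c := fun a b c => F.map_update_add _ _ _ _
    have Bsmul : ∀ (t : ℂ) a b, B a (t • b) = t * B a b := fun t a b => F.map_update_smul _ _ _ _
    have Badd' : ∀ a b c, B (a + b) c = B a c + B b c := fun a b c => by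
      rw [Bsymm, Badd, Bsymm a, Bsymm b]
    have Bsmul' : ∀ (t : ℂ) a b, B (t • a) b = t * B a b := fun t a b => by
      rw [Bsymm, Bsmul, Bsymm]
    have Bneg : ∀ a b, B a (-b) = -B a b := fun a b => by
      have := Bsmul (-1) a b
      simpa using this
    have Bneg' : ∀ a b, B (-a) b = -B a b := fun a b => by
      rw [Bsymm, Bneg, Bsymm]
    have hunit : ∀ a b, ‖a‖ = 1 → ‖b‖ = 1 →
        ∀ k, ‖Function.update (Function.update v i a) j b k‖ = 1 := by
      intro a b ha hb k
      simp only [Function.update_apply]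
      split_ifs <;> simp [*]
    have Ble : ∀ a b, ‖a‖ = 1 → ‖b‖ = 1 → ‖B a b‖ ≤ A := fun a b ha hb =>
      hmax _ (hunit a b ha hb)
    have Bdiag : ∀ a, ‖B a a‖ ≤ A * ‖a‖ ^ 2 := by
      intro a
      rcases eq_or_ne a 0 with rfl | ha
      · have := Bsmul 0 0 0
        simp only [smul_zero, zero_mul] at this
        simp [this]
      · have hna : ‖a‖ ≠ 0 := norm_ne_zero_iff.2 ha
        have h1 : ‖((‖a‖⁻¹ : ℝ) : ℂ) • a‖ = 1 := by
          rw [norm_smul]; simp [hna]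
        have h2 := Ble _ _ h1 h1
        rw [Bsmul, Bsmul'] at h2
        simp only [norm_mul, Complex.norm_real, norm_inv, norm_norm] at h2
        have h3 := mul_le_mul_of_nonneg_right h2 (sq_nonneg ‖a‖)
        calc ‖B a a‖ = ‖a‖⁻¹ * (‖a‖⁻¹ * ‖B a a‖) * ‖a‖ ^ 2 := by field_simp
          _ ≤ _ := h3
    set S := ∑ k, v k - x - y with hS
    have htot : ∀ a b, ∑ k, Function.update (Function.update v i a) j b k = S + (a + b) := by
      intro a b
      rw [Finset.sum_update_of_mem (mem_univ j)]
      have h1 : ∑ k ∈ univ \ {j}, Function.update v i a k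
          = ∑ k, Function.update v i a k - y := by
        rw [eq_sub_iff_add_eq, ← Finset.sum_sdiff (subset_univ {j})]
        simp [Function.update_of_ne hij.symm, hy]
      have h2 : ∑ k ∈ univ \ {i}, v k = ∑ k, v k - x := by
        rw [eq_sub_iff_add_eq, ← Finset.sum_sdiff (subset_univ {i})]
        simp [hx]
      rw [h1, Finset.sum_update_of_mem (mem_univ i), h2, hS]
      abel
    have hvS : ∑ k, v k = S + (x + y) := by rw [hS]; abel
    have opt : ∀ a b, ‖a‖ = 1 → ‖b‖ = 1 → ‖B a b‖ = A → ‖S + (a + b)‖ ≤ ‖S + (x + y)‖ := by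
      intro a b ha hb hab
      rw [← htot, ← hvS]
      exact hvmax _ (hunit a b ha hb) hab
    have hBA : ‖B x y‖ = A := by rw [Bxy, hvA]
    have nx : ‖x‖ = 1 := hv i
    have ny : ‖y‖ = 1 := hv j
    set w := x + y with hw
    have hpar : ‖w‖ ^ 2 + ‖x - y‖ ^ 2 = 4 := by
      have := parallelogram_law_with_norm ℂ x y
      rw [nx, ny] at this
      nlinarith
    have hxy0 : 0 < ‖x - y‖ := norm_pos_iff.2 (sub_ne_zero.2 hne)
    -- Replacing (x, y) by (-x, -y) keeps |B|, so maximality gives ‖S - w‖ ≤ ‖S + w‖.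
    have hre : 0 ≤ RCLike.re (inner ℂ S w) := by
      have h1 := opt (-x) (-y) (by simpa) (by simpa) (by rw [Bneg, Bneg', neg_neg, hBA])
      rw [show -x + -y = -w by rw [hw]; abel] at h1
      have h2 := norm_add_sq (𝕜 := ℂ) S w
      have h3 := norm_add_sq (𝕜 := ℂ) S (-w)
      have h4 := pow_le_pow_left₀ (norm_nonneg _) h1 2
      simp only [inner_neg_right, map_neg, norm_neg] at h3
      nlinarith
    -- If y = -x, the pairs (x, x) and (-x, -x) are maximisers too, and by the parallelogram law one
    -- of S ± 2x is longer than S = S + w.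
    have hw0 : w ≠ 0 := by
      intro h0
      have hyx : y = -x := by rw [eq_neg_iff_add_eq_zero, add_comm]; exact h0
      have hBxx : ‖B x x‖ = A := by rw [← hBA, hyx, Bneg, norm_neg]
      have h1 := opt x x nx nx hBxx
      have h2 := opt (-x) (-x) (by simpa) (by simpa) (by rw [Bneg, Bneg', neg_neg, hBxx])
      rw [← neg_add, h0, add_zero] at h2
      rw [h0, add_zero] at h1
      have h3 := parallelogram_law_with_norm ℂ S (x + x)
      rw [sub_eq_add_neg] at h3
      have h4 : ‖x + x‖ = 2 := by
        rw [← two_smul ℂ x, norm_smul, nx]; simp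
      rw [h4] at h3
      nlinarith [norm_nonneg (S + (x + x)), norm_nonneg (S + -(x + x)), norm_nonneg S]
    have hwpos : 0 < ‖w‖ := norm_pos_iff.2 hw0
    -- Polarisation: 4B(x,y) = B(w,w) - B(x-y,x-y), while ‖w‖² + ‖x-y‖² = 4. The diagonal bounds add
    -- up to exactly 4A, so they are equalities.
    have hBw : ‖B w w‖ = A * ‖w‖ ^ 2 := by
      apply le_antisymm (Bdiag w)
      have h1 : (4 : ℂ) * B x y = B w w - B (x - y) (x - y) := by
        rw [hw, show x - y = x + -y from sub_eq_add_neg x y]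
        simp only [Badd, Badd', Bneg, Bneg', Bsymm y x]
        ring
      have h2 : 4 * A ≤ ‖B w w‖ + A * ‖x - y‖ ^ 2 := by
        calc 4 * A = ‖(4 : ℂ) * B x y‖ := by rw [norm_mul, hBA]; simp
          _ ≤ ‖B w w‖ + ‖B (x - y) (x - y)‖ := by rw [h1]; exact norm_sub_le _ _
          _ ≤ _ := by gcongr; exact Bdiag _
      nlinarith
    have hw2 : ‖w‖ < 2 := by nlinarith
    set z : E := ((‖w‖⁻¹ : ℝ) : ℂ) • w with hz
    have nz : ‖z‖ = 1 := by rw [hz, norm_smul]; simp [hwpos.ne']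
    have hBz : ‖B z z‖ = A := by
      rw [hz, Bsmul, Bsmul']
      simp only [norm_mul, Complex.norm_real, norm_inv, norm_norm, hBw]
      field_simp
    -- The vector z + z is w stretched to length 2 > ‖w‖. As Re⟨S, w⟩ ≥ 0, the sum S + 2z is
    -- strictly longer than S + w, a contradiction.
    have h1 := opt z z nz nz hBz
    have hzz : z + z = ((2 * ‖w‖⁻¹ : ℝ) : ℂ) • w := by
      rw [hz, ← two_smul ℂ, smul_smul]; push_cast; rfl
    have h2 := norm_add_sq (𝕜 := ℂ) S w
    have h3 := norm_add_sq (𝕜 := ℂ) S (z + z)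
    have h4 := pow_le_pow_left₀ (norm_nonneg _) h1 2
    have h5 : ‖z + z‖ = 2 := by rw [← two_smul ℂ z, norm_smul, nz]; simp
    have h6 : RCLike.re (inner ℂ S (z + z)) = (2 * ‖w‖⁻¹) * RCLike.re (inner ℂ S w) := by
      rw [hzz, inner_smul_right]
      simp
    have h7 : 1 ≤ 2 * ‖w‖⁻¹ := by
      rw [← div_eq_mul_inv, le_div_iff₀ hwpos]; linarith
    rw [h5, h6] at h3
    nlinarith [mul_le_mul_of_nonneg_right h7 hre]
  refine (hmax u hu).trans ?_
  rw [← hvA]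
  obtain ⟨i⟩ := ‹Nonempty ι›
  rw [show v = fun _ => v i from funext fun j => key j i]
  exact hM _ (hv i)

/-! ### The spectral norm and the existence of the maximum -/

namespace SymEntanglement

theorem norm_tprod {n k : ℕ} (v : Fin k → EuclideanSpace ℂ (Fin n)) :
    ‖tprod v‖ = ∏ j, ‖v j‖ := by
  rw [← sq_eq_sq₀ (norm_nonneg _) (Finset.prod_nonneg fun _ _ => norm_nonneg _),
    EuclideanSpace.norm_sq_eq, ← Finset.prod_pow]
  simp_rw [EuclideanSpace.norm_sq_eq, Finset.prod_univ_sum, Fintype.piFinset_univ]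
  simp [tprod, Finset.prod_pow]

theorem tprod_update_apply {n k : ℕ} [DecidableEq (Fin k)] (v : Fin k → EuclideanSpace ℂ (Fin n))
    (j : Fin k) (z : EuclideanSpace ℂ (Fin n)) (i : Fin k → Fin n) :
    tprod (Function.update v j z) i = z (i j) * ∏ l ∈ Finset.univ.erase j, v l (i l) := by
  rw [tprod, PiLp.toLp_apply, ← Finset.mul_prod_erase _ _ (Finset.mem_univ j),
    Function.update_self]
  congr 1
  exact Finset.prod_congr rfl fun l hl => by
    rw [Function.update_of_ne (Finset.ne_of_mem_erase hl)]

/-- The multilinear map `v ↦ v₀ ⊗ ⋯ ⊗ v_{k-1}`. -/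
def tprodMultilinear (n k : ℕ) :
    MultilinearMap ℂ (fun _ : Fin k => EuclideanSpace ℂ (Fin n)) (Tensors n k) where
  toFun := tprod
  map_update_add' := by
    intro _ v j x y
    ext i
    simp only [tprod_update_apply, PiLp.add_apply, add_mul]
  map_update_smul' := by
    intro _ v j c x
    ext i
    simp only [tprod_update_apply, PiLp.smul_apply, smul_eq_mul, mul_assoc]

theorem continuous_tprod (n k : ℕ) : Continuous (tprod (n := n) (k := k)) := by
  refine (PiLp.continuous_toLp 2 _).comp (continuous_pi fun i => ?_)
  fun_prop

theorem inner_tprod_comp_perm {n m : ℕ} {T : Tensors n m}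
    (hT : ∀ σ : Equiv.Perm (Fin m), permute σ T = T) (σ : Equiv.Perm (Fin m))
    (v : Fin m → EuclideanSpace ℂ (Fin n)) :
    inner ℂ T (tprod (v ∘ σ)) = inner ℂ T (tprod v) := by
  have hTσ : ∀ i, T (i ∘ σ) = T i := fun i => by
    conv_rhs => rw [← hT σ]
    rfl
  simp only [PiLp.inner_apply, tprod]
  refine Fintype.sum_equiv (Equiv.arrowCongr σ (Equiv.refl (Fin n))) _ _ fun i => ?_
  have h1 : T ((Equiv.arrowCongr σ (Equiv.refl (Fin n))) i) = T i := by
    rw [← hTσ]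
    exact congrArg T.ofLp (funext fun j => by simp)
  rw [h1]
  congr 1
  exact Fintype.prod_equiv σ _ _ fun j => by simp

theorem bddAbove_specNorm {n k : ℕ} (T : Tensors n k) :
    BddAbove {x : ℝ | ∃ u : Tensors n k, IsPure u ∧ ‖u‖ = 1 ∧ x = ‖inner ℂ T u‖} := by
  refine ⟨‖T‖, ?_⟩
  rintro x ⟨u, -, hu, rfl⟩
  simpa [hu] using norm_inner_le_norm (𝕜 := ℂ) T u

theorem norm_inner_le_specNorm {n k : ℕ} (T : Tensors n k) {u : Tensors n k} (hu : IsPure u)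
    (hu1 : ‖u‖ = 1) : ‖inner ℂ T u‖ ≤ specNorm T :=
  le_csSup (bddAbove_specNorm T) ⟨u, hu, hu1, rfl⟩

theorem specNorm_le {n k : ℕ} (T : Tensors n k) {B : ℝ} (hB : 0 ≤ B)
    (h : ∀ v : Fin k → EuclideanSpace ℂ (Fin n), (∀ j, ‖v j‖ = 1) → ‖inner ℂ T (tprod v)‖ ≤ B) :
    specNorm T ≤ B := by
  refine Real.sSup_le ?_ hB
  rintro x ⟨u, ⟨v, rfl⟩, hu, rfl⟩
  rw [norm_tprod] at hu
  have hv : ∀ j, ‖v j‖ ≠ 0 := fun j h0 => by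
    rw [Finset.prod_eq_zero (Finset.mem_univ j) h0] at hu
    exact zero_ne_one hu
  -- The norms of the factors multiply to 1, so normalising every factor leaves the tensor
  -- unchanged.
  have h1 := h (fun j => ((‖v j‖⁻¹ : ℝ) : ℂ) • v j) fun j => by
    rw [norm_smul]; simp [hv j]
  have h2 : tprod (fun j => ((‖v j‖⁻¹ : ℝ) : ℂ) • v j) = tprod v := by
    have h3 := (tprodMultilinear n k).map_smul_univ (fun j => ((‖v j‖⁻¹ : ℝ) : ℂ)) v
    rw [← Complex.ofReal_prod, Finset.prod_inv_distrib, hu] at h3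
    simpa [tprodMultilinear] using h3
  rwa [h2] at h1

/-- For a symmetric tensor the spectral norm is determined by the powers `v ⊗ ⋯ ⊗ v`. -/
theorem specNorm_le_of_symm {n m : ℕ} (hm : 1 ≤ m) {T : Tensors n m}
    (hT : ∀ σ : Equiv.Perm (Fin m), permute σ T = T) {B : ℝ} (hB : 0 ≤ B)
    (h : ∀ x : EuclideanSpace ℂ (Fin n), ‖x‖ = 1 → ‖inner ℂ T (tprod fun _ => x)‖ ≤ B) :
    specNorm T ≤ B := by
  have : Nonempty (Fin m) := ⟨⟨0, hm⟩⟩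
  refine specNorm_le T hB fun v hv => ?_
  exact norm_symm_multilinear_le
    (((innerSL ℂ T : Tensors n m →L[ℂ] ℂ) : Tensors n m →ₗ[ℂ] ℂ).compMultilinearMap
      (tprodMultilinear n m))
    ((innerSL ℂ T).continuous.comp (continuous_tprod n m))
    (fun σ v => inner_tprod_comp_perm hT σ v) h v hv

theorem specNorm_le_norm {n k : ℕ} (T : Tensors n k) : specNorm T ≤ ‖T‖ :=
  Real.sSup_le (by
    rintro x ⟨u, -, hu, rfl⟩
    simpa [hu] using norm_inner_le_norm (𝕜 := ℂ) T u) (norm_nonneg _)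

theorem specNorm_nonneg {n k : ℕ} (T : Tensors n k) : 0 ≤ specNorm T :=
  Real.sSup_nonneg (by rintro x ⟨u, -, -, rfl⟩; exact norm_nonneg _)

theorem specNorm_add_le {n k : ℕ} (T U : Tensors n k) :
    specNorm (T + U) ≤ specNorm T + specNorm U := by
  refine Real.sSup_le ?_ (add_nonneg (specNorm_nonneg T) (specNorm_nonneg U))
  rintro x ⟨u, hu, hu1, rfl⟩
  rw [inner_add_left]
  exact (norm_add_le _ _).trans
    (add_le_add (norm_inner_le_specNorm T hu hu1) (norm_inner_le_specNorm U hu hu1))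

theorem continuous_specNorm (n k : ℕ) : Continuous (specNorm (n := n) (k := k)) := by
  refine LipschitzWith.continuous (K := 1) (LipschitzWith.of_le_add fun T U => ?_)
  calc specNorm T = specNorm (U + (T - U)) := by congr 1; abel
    _ ≤ specNorm U + specNorm (T - U) := specNorm_add_le _ _
    _ ≤ specNorm U + dist T U := by
      rw [dist_eq_norm]; gcongr; exact specNorm_le_norm _

theorem tprod_single {n k : ℕ} (i : Fin k → Fin n) :
    tprod (fun j => EuclideanSpace.single (i j) (1 : ℂ)) = EuclideanSpace.single i 1 := by
  ext l
  simp only [tprod, PiLp.single_apply]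
  split_ifs with h
  · subst h; simp
  · obtain ⟨j, hj⟩ := Function.ne_iff.1 h
    exact Finset.prod_eq_zero (Finset.mem_univ j) (by simp [hj])

theorem specNorm_pos {n k : ℕ} {T : Tensors n k} (hT : T ≠ 0) : 0 < specNorm T := by
  obtain ⟨i, hi⟩ : ∃ i, T i ≠ 0 := by
    by_contra! h
    exact hT (by ext i; simpa using h i)
  have h := norm_inner_le_specNorm T (u := EuclideanSpace.single i 1) ⟨_, (tprod_single i).symm⟩
    (by simp)
  refine lt_of_lt_of_le ?_ h
  simpa [EuclideanSpace.inner_single_right] using hi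

theorem isCompact_unitSym (n m : ℕ) : IsCompact (unitSym n m) := by
  have h : unitSym n m = Metric.sphere 0 1 ∩ ⋂ σ, {T | permute σ T = T} := by
    ext T
    simp [unitSym, and_comm]
  rw [h]
  refine (isCompact_sphere _ _).inter_right (isClosed_iInter fun σ => ?_)
  refine isClosed_eq ((PiLp.continuous_toLp 2 _).comp (continuous_pi fun i => ?_)) continuous_id
  fun_prop

theorem unitSym_nonempty {n : ℕ} (hn : 0 < n) (m : ℕ) : (unitSym n m).Nonempty := by
  refine ⟨EuclideanSpace.single (fun _ => ⟨0, hn⟩) 1, fun σ => ?_, by simp⟩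
  ext i
  simp only [permute, PiLp.single_apply]
  congr 1
  simp only [eq_iff_iff, funext_iff, Function.comp]
  exact ⟨fun h j => by simpa using h (σ.symm j), fun h j => h _⟩

/-- The maximal entanglement of symmetric tensors is attained. -/
theorem isGreatest_maxSymEntanglement {n : ℕ} (hn : 0 < n) (m : ℕ) :
    IsGreatest (entanglement '' unitSym n m) (maxSymEntanglement n m) := by
  refine IsCompact.isGreatest_sSup ?_ ((unitSym_nonempty hn m).image _)
  refine (isCompact_unitSym n m).image_of_continuousOn fun T hT => ?_
  have hT0 : T ≠ 0 := by
    rintro rfl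
    simpa using hT.2
  refine ContinuousAt.continuousWithinAt ?_
  exact continuousAt_const.mul
    (((continuous_specNorm n m).continuousAt.log (specNorm_pos hT0).ne').div_const _)

end SymEntanglement

/-! ### Moments of complex Gaussian vectors -/

section Gaussian

open MeasureTheory

theorem integral_norm_pow_mul_gaussian (a : ℕ) :
    ∫ z : ℂ, ‖z‖ ^ (2 * a) * (Real.exp (-‖z‖ ^ 2) / Real.pi) = (a.factorial : ℝ) := by
  have h := Complex.integral_rpow_mul_exp_neg_rpow (p := 2) (q := (2 * a : ℕ)) (by norm_num)
    (lt_of_lt_of_le (by norm_num) (Nat.cast_nonneg _))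
  have e : ((2 * a : ℕ) + 2 : ℝ) / 2 = a + 1 := by push_cast; ring
  rw [e, Real.Gamma_nat_eq_factorial] at h
  simp only [Real.rpow_natCast, Real.rpow_two] at h
  simp only [← mul_div_assoc]
  rw [integral_div, h]
  field_simp

/-- The integral of a non-integrable function is 0 by convention, whereas this one equals a! ≠ 0. -/
theorem integrable_norm_pow_mul_gaussian (a : ℕ) :
    Integrable fun z : ℂ => ‖z‖ ^ (2 * a) * (Real.exp (-‖z‖ ^ 2) / Real.pi) := by
  by_contra h
  have := integral_norm_pow_mul_gaussian a
  rw [integral_undef h] at this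
  exact a.factorial_ne_zero (by exact_mod_cast this.symm)

theorem integrable_pow_mul_conj_pow_gaussian (a b : ℕ) :
    Integrable fun z : ℂ =>
      z ^ a * (starRingEnd ℂ z) ^ b * ((Real.exp (-‖z‖ ^ 2) / Real.pi : ℝ) : ℂ) := by
  refine ((integrable_norm_pow_mul_gaussian a).add (integrable_norm_pow_mul_gaussian b)).mono
    (by fun_prop) (Filter.Eventually.of_forall fun z => ?_)
  have h0 : 0 ≤ Real.exp (-‖z‖ ^ 2) / Real.pi := by positivity
  simp only [norm_mul, norm_pow, RCLike.norm_conj, Complex.norm_real, Real.norm_eq_abs,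
    Pi.add_apply]
  rw [abs_of_nonneg h0, ← add_mul, abs_of_nonneg (by positivity)]
  gcongr
  rw [pow_mul', pow_mul']
  nlinarith [sq_nonneg (‖z‖ ^ a - ‖z‖ ^ b), pow_nonneg (norm_nonneg z) a,
    pow_nonneg (norm_nonneg z) b]

theorem integral_pow_mul_conj_pow_gaussian (a b : ℕ) :
    ∫ z : ℂ, z ^ a * (starRingEnd ℂ z) ^ b * ((Real.exp (-‖z‖ ^ 2) / Real.pi : ℝ) : ℂ)
      = if a = b then (a.factorial : ℂ) else 0 := by
  split_ifs with hab
  · subst hab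
    have h : ∀ z : ℂ, z ^ a * (starRingEnd ℂ z) ^ a * ((Real.exp (-‖z‖ ^ 2) / Real.pi : ℝ) : ℂ)
        = ((‖z‖ ^ (2 * a) * (Real.exp (-‖z‖ ^ 2) / Real.pi) : ℝ) : ℂ) := fun z => by
      rw [← mul_pow, Complex.mul_conj']
      push_cast
      ring
    simp_rw [h]
    rw [integral_complex_ofReal, integral_norm_pow_mul_gaussian]
    simp
  · set f : ℂ → ℂ := fun z =>
      z ^ a * (starRingEnd ℂ z) ^ b * ((Real.exp (-‖z‖ ^ 2) / Real.pi : ℝ) : ℂ) with hf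
    have hab' : ((a : ℝ) - b) ≠ 0 := sub_ne_zero.2 (by exact_mod_cast hab)
    -- The angle is chosen so that u^(a-b) = -1: this rotation preserves the measure and negates the
    -- integrand.
    set u : Circle := Circle.exp (Real.pi / (a - b)) with hu
    have hu1 : (u : ℂ) ^ a * (starRingEnd ℂ (u : ℂ)) ^ b = -1 := by
      rw [← Circle.coe_inv_eq_conj, hu, ← Circle.exp_neg, Circle.coe_exp, Circle.coe_exp,
        ← Complex.exp_nat_mul, ← Complex.exp_nat_mul, ← Complex.exp_add, ← Complex.exp_pi_mul_I]
      congr 1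
      have : ((a : ℂ) - b) ≠ 0 := by exact_mod_cast hab'
      push_cast
      field_simp
      ring
    have h1 : ∫ z, f (rotation u z) = ∫ z, f z :=
      ((rotation u).measurePreserving).integral_comp
        (rotation u).toHomeomorph.measurableEmbedding f
    have h2 : ∀ z, f (rotation u z) = -f z := fun z => by
      have hn : ‖(u : ℂ) * z‖ = ‖z‖ := by rw [norm_mul, Circle.norm_coe, one_mul]
      simp only [hf, rotation_apply, hn, map_mul, mul_pow]
      linear_combination (z ^ a * (starRingEnd ℂ z) ^ b *
        ((Real.exp (-‖z‖ ^ 2) / Real.pi : ℝ) : ℂ)) * hu1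
    simp_rw [h2] at h1
    rw [integral_neg] at h1
    exact self_eq_neg.1 h1.symm

/-- The density of the standard complex Gaussian vector. -/
noncomputable def gaussianDensity {ι : Type*} [Fintype ι] (d : ι → ℂ) : ℝ :=
  ∏ k, Real.exp (-‖d k‖ ^ 2) / Real.pi

section Wick

variable {ι P : Type*} [Fintype ι] [Fintype P] [DecidableEq ι]

theorem monomial_mul_conj_monomial (κ κ' : P → ι) (d : ι → ℂ) :
    (∏ j, d (κ j)) * (∏ j, starRingEnd ℂ (d (κ' j))) * (gaussianDensity d : ℂ)
      = ∏ k, (d k ^ Fintype.card {j // κ j = k} *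
        (starRingEnd ℂ (d k)) ^ Fintype.card {j // κ' j = k} *
        ((Real.exp (-‖d k‖ ^ 2) / Real.pi : ℝ) : ℂ)) := by
  rw [Finset.prod_mul_distrib, Finset.prod_mul_distrib, gaussianDensity, Complex.ofReal_prod]
  congr 2
  · rw [← Fintype.prod_fiberwise' κ d]
    simp
  · rw [← Fintype.prod_fiberwise' κ' fun k => starRingEnd ℂ (d k)]
    simp

theorem integrable_monomial_gaussian (κ κ' : P → ι) :
    Integrable fun d : ι → ℂ =>
      (∏ j, d (κ j)) * (∏ j, starRingEnd ℂ (d (κ' j))) * (gaussianDensity d : ℂ) := by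
  simp_rw [monomial_mul_conj_monomial]
  exact Integrable.fintype_prod fun k => integrable_pow_mul_conj_pow_gaussian _ _

/-- Wick's formula. -/
theorem integral_monomial_gaussian [DecidableEq P] (κ κ' : P → ι) :
    ∫ d : ι → ℂ, (∏ j, d (κ j)) * (∏ j, starRingEnd ℂ (d (κ' j))) * (gaussianDensity d : ℂ)
      = (Finset.univ.filter fun σ : Equiv.Perm P => κ ∘ σ = κ').card := by
  simp_rw [monomial_mul_conj_monomial]
  rw [integral_fintype_prod_volume_eq_prod fun (k : ι) (z : ℂ) =>
    z ^ Fintype.card {j // κ j = k} * (starRingEnd ℂ z) ^ Fintype.card {j // κ' j = k} *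
        ((Real.exp (-‖z‖ ^ 2) / Real.pi : ℝ) : ℂ)]
  simp_rw [integral_pow_mul_conj_pow_gaussian]
  by_cases h : ∀ k, Fintype.card {j // κ j = k} = Fintype.card {j // κ' j = k}
  · have e : ∀ k, {j // κ' j = k} ≃ {j // κ j = k} := fun k => Fintype.equivOfCardEq (h k).symm
    -- Equal fibre sizes give τ with κ ∘ τ = κ'. The permutations counted then form a coset of the
    -- stabiliser of κ, whose order is the product of the factorials of the fibre sizes.
    set τ : Equiv.Perm P := Equiv.ofFiberEquiv e with hτ
    have hτ' : κ ∘ τ = κ' := funext fun j => Equiv.ofFiberEquiv_map e j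
    simp_rw [if_pos (h _)]
    rw [← Nat.cast_prod, ← DomMulAct.stabilizer_card κ, Fintype.card_subtype]
    congr 1
    refine Finset.card_equiv (Equiv.mulRight τ) fun σ => ?_
    simp only [Finset.mem_filter, Finset.mem_univ, true_and, Equiv.coe_mulRight,
      Equiv.Perm.coe_mul, ← hτ', ← Function.comp_assoc]
    exact (τ.surjective.injective_comp_right.eq_iff).symm
  · rw [Finset.filter_false_of_mem]
    · push Not at h
      obtain ⟨k, hk⟩ := h
      rw [Finset.prod_eq_zero (Finset.mem_univ k) (if_neg hk)]
      simp
    · rintro σ - rfl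
      exact h fun k => Fintype.card_congr
        (σ.symm.subtypeEquiv fun j => by simp)

/-- Induction on p, as in Pólya's urn: prepending the letter a to κ multiplies the stabiliser order
by c a + 1, where c a is the number of occurrences of a, and these factors sum over a to n + p. -/
theorem sum_card_stabilizer (n p : ℕ) :
    ∑ κ : Fin p → Fin n, (Finset.univ.filter fun σ : Equiv.Perm (Fin p) => κ ∘ σ = κ).card
      = n.ascFactorial p := by
  have h : ∀ κ : Fin p → Fin n, (Finset.univ.filter fun σ : Equiv.Perm (Fin p) => κ ∘ σ = κ).card
      = ∏ k, (∑ j, if κ j = k then 1 else 0).factorial := fun κ => by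
    rw [← Fintype.card_subtype, DomMulAct.stabilizer_card]
    simp [Fintype.card_subtype]
  simp_rw [h]
  clear h
  induction p with
  | zero => simp
  | succ p ih =>
    rw [← (Fin.consEquiv fun _ => Fin n).sum_comp, Fintype.sum_prod_type, Finset.sum_comm,
      Nat.ascFactorial_succ, ← ih, Finset.mul_sum]
    refine Finset.sum_congr rfl fun κ _ => ?_
    set c : Fin n → ℕ := fun k => ∑ j, if κ j = k then 1 else 0 with hc
    have hsum : ∑ k, c k = p := by
      rw [hc, Finset.sum_comm]
      simp
    have hstep : ∀ a, ∏ k,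
        (∑ j, if Fin.consEquiv (fun _ => Fin n) (a, κ) j = k then 1 else 0).factorial = (c a + 1) * ∏ k, (c k).factorial := fun a => by
      simp only [Fin.consEquiv_apply, Fin.sum_univ_succ, Fin.cons_zero, Fin.cons_succ]
      rw [← Finset.mul_prod_erase _ _ (Finset.mem_univ a),
        ← Finset.mul_prod_erase Finset.univ (fun k => (c k).factorial) (Finset.mem_univ a),
        ← mul_assoc, ← Nat.factorial_succ]
      congr 1
      · simp [hc, add_comm]
      · exact Finset.prod_congr rfl fun k hk => by
          rw [if_neg (Finset.ne_of_mem_erase hk).symm, zero_add]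
    simp_rw [hstep]
    rw [← Finset.sum_mul, Finset.sum_add_distrib, hsum, Finset.sum_const, Finset.card_univ,
      Fintype.card_fin, smul_eq_mul, mul_one, add_comm]

end Wick

end Gaussian

/-! ### Numerical estimates and the choice of p -/

/-- A Stirling-type bound, cubed so that it matches exp(2(L - 1)) = 16m³. The inequality fails at p
= 7, so the induction has to start at 8. -/
theorem factorial_pow_three_mul_exp_le {p : ℕ} (hp : 8 ≤ p) :
    ((p + 1).factorial : ℝ) ^ 3 * Real.exp (2 * ((p : ℝ) - 1)) ≤ 16 * (p : ℝ) ^ (3 * p) := by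
  induction p, hp using Nat.le_induction with
  | base =>
    have h : Real.exp (2 * (((8 : ℕ) : ℝ) - 1)) = Real.exp 1 ^ 14 := by
      rw [← Real.exp_nat_mul]; norm_num
    rw [h]
    calc _ ≤ ((8 + 1).factorial : ℝ) ^ 3 * 2.7182818286 ^ 14 := by
          gcongr; exact Real.exp_one_lt_d9.le
      _ ≤ _ := by norm_num [Nat.factorial]
  | succ p hp ih =>
    have hp0 : (0 : ℝ) < p := by exact_mod_cast (by omega : 0 < p)
    set t : ℝ := 1 / ((p : ℝ) + 1) with ht
    have h1 : (p : ℝ) + 2 ≤ (p + 1) * Real.exp t := by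
      have := mul_le_mul_of_nonneg_left (Real.add_one_le_exp t) (by positivity : 0 ≤ (p : ℝ) + 1)
      calc (p : ℝ) + 2 = (p + 1) * (t + 1) := by rw [ht]; field_simp; ring
        _ ≤ _ := this
    have h2 : (p : ℝ) * Real.exp t ≤ p + 1 := by
      have h3 := Real.add_one_le_exp (-t)
      rw [Real.exp_neg] at h3
      have h4 : -t + 1 = p / (p + 1) := by rw [ht]; field_simp; ring
      rw [h4, div_le_iff₀ (by positivity), inv_mul_eq_div, le_div_iff₀ (Real.exp_pos _)] at h3
      exact h3
    have h5 : Real.exp t ^ 3 * Real.exp 2 ≤ Real.exp t ^ (3 * p) := by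
      rw [← Real.exp_nat_mul, ← Real.exp_nat_mul, ← Real.exp_add, Real.exp_le_exp, ht]
      have : (8 : ℝ) ≤ p := by exact_mod_cast hp
      rw [mul_one_div, mul_one_div, div_add' _ _ _ (by positivity),
        div_le_div_iff_of_pos_right (by positivity)]
      push_cast
      linarith
    have e1 : Real.exp (2 * (((p + 1 : ℕ) : ℝ) - 1))
        = Real.exp (2 * ((p : ℝ) - 1)) * Real.exp 2 := by
      rw [← Real.exp_add]; push_cast; ring_nf
    have e2 : ((p + 1 + 1).factorial : ℝ) = (p + 2) * (p + 1).factorial := by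
      rw [Nat.factorial_succ]; push_cast; ring
    rw [e1, e2]
    calc (((p : ℝ) + 2) * (p + 1).factorial) ^ 3 * (Real.exp (2 * ((p : ℝ) - 1)) * Real.exp 2)
        = ((p : ℝ) + 2) ^ 3 * Real.exp 2 *
          (((p + 1).factorial : ℝ) ^ 3 * Real.exp (2 * ((p : ℝ) - 1))) := by ring
      _ ≤ ((p + 1) * Real.exp t) ^ 3 * Real.exp 2 * (16 * (p : ℝ) ^ (3 * p)) := by gcongr
      _ = 16 * ((p + 1) ^ 3 * (p : ℝ) ^ (3 * p)) * (Real.exp t ^ 3 * Real.exp 2) := by ring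
      _ ≤ 16 * ((p + 1) ^ 3 * (p : ℝ) ^ (3 * p)) * Real.exp t ^ (3 * p) := by gcongr
      _ = 16 * ((p + 1) ^ 3 * ((p : ℝ) * Real.exp t) ^ (3 * p)) := by rw [mul_pow]; ring
      _ ≤ 16 * ((p + 1) ^ 3 * ((p : ℝ) + 1) ^ (3 * p)) := by gcongr
      _ = 16 * ((p + 1 : ℕ) : ℝ) ^ (3 * (p + 1)) := by push_cast; ring

theorem two_mul_log_four_mul_sqrt {x : ℝ} (hx : 0 < x) :
    2 * Real.log (4 * x * √x) = Real.log (16 * x ^ 3) := by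
  have h : (16 * x ^ 3 : ℝ) = (4 * x * √x) ^ 2 := by
    rw [mul_pow, Real.sq_sqrt hx.le]; ring
  rw [h, Real.log_pow]; norm_num

/-- Certifies ln(4m√m) ≥ a/(2b) for all m ≥ m₀ by rational arithmetic, with a decimal upper bound
for e. -/
theorem le_log_of_exp_bound {m m₀ a b : ℕ} (h0 : 0 < m₀) (hm : m₀ ≤ m)
    (h : (2.7182818286 : ℝ) ^ a ≤ (16 * (m₀ : ℝ) ^ 3) ^ b) :
    (a : ℝ) ≤ 2 * b * Real.log (4 * (m : ℝ) * √(m : ℝ)) := by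
  have hm0 : (0 : ℝ) < m := by exact_mod_cast h0.trans_le hm
  have h0' : (0 : ℝ) < m₀ := by exact_mod_cast h0
  calc (a : ℝ) = Real.log (Real.exp 1 ^ a) := by simp
    _ ≤ Real.log ((16 * (m : ℝ) ^ 3) ^ b) := by
      apply Real.log_le_log (by positivity)
      calc Real.exp 1 ^ a ≤ (2.7182818286 : ℝ) ^ a := by gcongr; exact Real.exp_one_lt_d9.le
        _ ≤ _ := h
        _ ≤ _ := by gcongr
    _ = _ := by rw [Real.log_pow, ← two_mul_log_four_mul_sqrt hm0]; ring

/-- In this range L/m ≥ 1, so the trivial bound on the spectral norm suffices; the inequality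
already fails at m = 5. -/
theorem le_one_add_log_of_le_four {m : ℕ} (hm : 1 ≤ m) (hm4 : m ≤ 4) :
    (m : ℝ) ≤ 1 + Real.log (4 * (m : ℝ) * √(m : ℝ)) := by
  interval_cases m
  · have := le_log_of_exp_bound (m := 1) (m₀ := 1) (a := 0) (b := 1) (by norm_num) le_rfl
      (by norm_num)
    push_cast at *; linarith
  · have := le_log_of_exp_bound (m := 2) (m₀ := 2) (a := 2) (b := 1) (by norm_num) le_rfl
      (by norm_num)
    push_cast at *; linarith
  · have := le_log_of_exp_bound (m := 3) (m₀ := 3) (a := 4) (b := 1) (by norm_num) le_rfl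
      (by norm_num)
    push_cast at *; linarith
  · have := le_log_of_exp_bound (m := 4) (m₀ := 4) (a := 6) (b := 1) (by norm_num) le_rfl
      (by norm_num)
    push_cast at *; linarith

/-- Since mp + 1 ≤ m(p+1) and m^p ≤ (m+1)⋯(m+p), it is enough that m(p+1)! ≤ L^p. This is the
preceding factorial bound at p = ⌊L⌋, after a correction for the fractional part of L. -/
theorem exists_moment_bound_of_eight_le {m : ℕ} (hm : 1 ≤ m) {L : ℝ}
    (hL : L = 1 + Real.log (4 * (m : ℝ) * √(m : ℝ))) (hL8 : 8 ≤ L) :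
    ∃ p : ℕ, 1 ≤ p ∧ (p.factorial : ℝ) * (m * p + 1) * (m : ℝ) ^ p
      ≤ L ^ p * ((m + 1).ascFactorial p : ℕ) := by
  have hm0 : (1 : ℝ) ≤ m := by exact_mod_cast hm
  have hL0 : 0 < L := by linarith
  set p := ⌊L⌋₊ with hp
  have hp8 : 8 ≤ p := Nat.le_floor (by exact_mod_cast hL8)
  have hp8' : (8 : ℝ) ≤ p := by exact_mod_cast hp8
  have hpL : (p : ℝ) ≤ L := Nat.floor_le hL0.le
  have hLp : L < p + 1 := Nat.lt_floor_add_one L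
  have hexp : Real.exp (2 * (L - 1)) = 16 * (m : ℝ) ^ 3 := by
    rw [hL, add_sub_cancel_left, two_mul_log_four_mul_sqrt (by linarith), Real.exp_log]
    positivity
  have h1 : (p : ℝ) * Real.exp ((L - p) / L) ≤ L := by
    have h3 := Real.add_one_le_exp (-((L - p) / L))
    rw [Real.exp_neg] at h3
    have h4 : -((L - p) / L) + 1 = p / L := by field_simp; ring
    rw [h4, div_le_iff₀ (by positivity), inv_mul_eq_div, le_div_iff₀ (Real.exp_pos _)] at h3
    exact h3
  -- This amounts to 2L ≤ 3p when L > p, and it holds because L < p + 1 and p ≥ 8.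
  have h2 : Real.exp (2 * (L - p)) ≤ Real.exp ((L - p) / L) ^ (3 * p) := by
    rw [← Real.exp_nat_mul, Real.exp_le_exp, mul_div_assoc', le_div_iff₀ hL0]
    push_cast
    nlinarith [mul_nonneg (sub_nonneg.2 hpL) (by linarith : 0 ≤ 3 * (p : ℝ) - 2 * L)]
  have h3 : ((m : ℝ) * (p + 1).factorial) ^ 3 ≤ (L ^ p) ^ 3 := by
    have h5 : 16 * ((m : ℝ) * (p + 1).factorial) ^ 3 ≤ 16 * (L ^ p) ^ 3 := by
      calc 16 * ((m : ℝ) * (p + 1).factorial) ^ 3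
          = Real.exp (2 * (L - 1)) * ((p + 1).factorial : ℝ) ^ 3 := by rw [hexp]; ring
        _ = Real.exp (2 * (L - p)) *
            (((p + 1).factorial : ℝ) ^ 3 * Real.exp (2 * ((p : ℝ) - 1))) := by
          rw [show 2 * (L - 1) = 2 * (L - p) + 2 * ((p : ℝ) - 1) by ring, Real.exp_add]; ring
        _ ≤ Real.exp ((L - p) / L) ^ (3 * p) * (16 * (p : ℝ) ^ (3 * p)) :=
          mul_le_mul h2 (factorial_pow_three_mul_exp_le hp8) (by positivity) (by positivity)
        _ = 16 * ((p : ℝ) * Real.exp ((L - p) / L)) ^ (3 * p) := by rw [mul_pow]; ring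
        _ ≤ 16 * L ^ (3 * p) := by gcongr
        _ = 16 * (L ^ p) ^ 3 := by rw [← pow_mul, mul_comm 3 p]
    linarith
  have h4 : (m : ℝ) * (p + 1).factorial ≤ L ^ p :=
    le_of_pow_le_pow_left₀ (by norm_num) (by positivity) h3
  refine ⟨p, by omega, ?_⟩
  have h6 : (m : ℝ) ^ p ≤ ((m + 1).ascFactorial p : ℕ) := by
    have := Nat.pow_succ_le_ascFactorial (m + 1) p
    calc (m : ℝ) ^ p ≤ ((m : ℝ) + 1) ^ p := by gcongr; linarith
      _ ≤ _ := by exact_mod_cast this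
  refine mul_le_mul (le_trans ?_ h4) h6 (by positivity) (by positivity)
  rw [Nat.factorial_succ]
  push_cast
  nlinarith [(by positivity : 0 ≤ (p.factorial : ℝ))]

/-- The numerical estimate behind the choice of the moment. -/
theorem exists_moment_bound {m : ℕ} (hm : 5 ≤ m) :
    ∃ p : ℕ, 1 ≤ p ∧ (p.factorial : ℝ) * (m * p + 1) * (m : ℝ) ^ p
      ≤ (1 + Real.log (4 * (m : ℝ) * √(m : ℝ))) ^ p * ((m + 1).ascFactorial p : ℕ) := by
  by_cases h43 : 43 ≤ m
  · refine exists_moment_bound_of_eight_le (by omega) rfl ?_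
    -- The least m with L ≥ 8 is 43, as 16·43³ > e¹⁴ > 16·42³.
    have := le_log_of_exp_bound (m₀ := 43) (a := 14) (b := 1) (by norm_num) h43 (by norm_num)
    push_cast at this; linarith
  refine ⟨4, by norm_num, ?_⟩
  -- On each of the ranges below, L is replaced by the rational lower bound t = 1 + a/(2b) valid at
  -- its left endpoint; the rest is a finite check.
  have key : ∀ t : ℝ, 0 ≤ t → t ≤ 1 + Real.log (4 * (m : ℝ) * √(m : ℝ)) →
      ((4 : ℕ).factorial : ℝ) * (m * (4 : ℕ) + 1) * (m : ℝ) ^ 4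
        ≤ t ^ 4 * ((m + 1).ascFactorial 4 : ℕ) →
      ((4 : ℕ).factorial : ℝ) * (m * (4 : ℕ) + 1) * (m : ℝ) ^ 4
        ≤ (1 + Real.log (4 * (m : ℝ) * √(m : ℝ))) ^ 4 * ((m + 1).ascFactorial 4 : ℕ) :=
    fun t ht htL h => h.trans (by gcongr)
  by_cases h33 : 33 ≤ m
  · have := le_log_of_exp_bound (m₀ := 33) (a := 66) (b := 5) (by norm_num) h33 (by norm_num)
    push_cast at this
    refine key 7.6 (by norm_num) (by linarith) ?_
    clear this key
    interval_cases m <;> norm_num [Nat.ascFactorial, Nat.factorial]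
  by_cases h22 : 22 ≤ m
  · have := le_log_of_exp_bound (m₀ := 22) (a := 12) (b := 1) (by norm_num) h22 (by norm_num)
    push_cast at this
    refine key 7 (by norm_num) (by linarith) ?_
    clear this key
    interval_cases m <;> norm_num [Nat.ascFactorial, Nat.factorial]
  by_cases h12 : 12 ≤ m
  · have := le_log_of_exp_bound (m₀ := 12) (a := 51) (b := 5) (by norm_num) h12 (by norm_num)
    push_cast at this
    refine key 6.1 (by norm_num) (by linarith) ?_
    clear this key
    interval_cases m <;> norm_num [Nat.ascFactorial, Nat.factorial]
  · have := le_log_of_exp_bound (m₀ := 5) (a := 15) (b := 2) (by norm_num) hm (by norm_num)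
    push_cast at this
    refine key 4.75 (by norm_num) (by linarith) ?_
    clear this key
    interval_cases m <;> norm_num [Nat.ascFactorial, Nat.factorial]

/-! ### Gaussian average of the Bombieri norm of a power -/

section GaussianAverage

open MeasureTheory

section Moment

variable (m p : ℕ)

/-- The weights `√(m choose k)` of the monomials in the Bombieri norm. -/
noncomputable def binomWeight (k : Fin (m + 1)) : ℝ := √(m.choose k : ℝ)

/-- The binary form with coefficients `d` in the Bombieri-orthonormal basis of monomials. -/
noncomputable def binaryForm (d : Fin (m + 1) → ℂ) (x y : ℂ) : ℂ :=
  ∑ k, d k * (binomWeight m k : ℂ) * (x ^ (k : ℕ) * y ^ (m - k))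

/-- The tuples of exponents that contribute to the monomial `x ^ K` of the `p`-th power. -/
def exponentTuples (K : ℕ) : Finset (Fin p → Fin (m + 1)) :=
  Finset.univ.filter fun κ => ∑ j, (κ j : ℕ) = K

/-- The product of the weights along a tuple of exponents. -/
noncomputable def tupleWeight {m p : ℕ} (κ : Fin p → Fin (m + 1)) : ℝ := ∏ j, binomWeight m (κ j)

/-- The coefficient of `x ^ K` in the `p`-th power of a binary form. -/
noncomputable def powCoeff (d : Fin (m + 1) → ℂ) (K : ℕ) : ℂ :=
  ∑ κ ∈ exponentTuples m p K, (tupleWeight κ : ℂ) * ∏ j, d (κ j)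

/-- The squared Bombieri norm of the `p`-th power of a binary form. -/
noncomputable def powBombieri (d : Fin (m + 1) → ℂ) : ℝ :=
  ∑ K ∈ Finset.range (m * p + 1), ‖powCoeff m p d K‖ ^ 2 / ((m * p).choose K : ℝ)

theorem sum_tuple_le {m p : ℕ} (κ : Fin p → Fin (m + 1)) : ∑ j, (κ j : ℕ) ≤ m * p := by
  calc ∑ j, (κ j : ℕ) ≤ ∑ _j : Fin p, m := Finset.sum_le_sum fun j _ => Nat.lt_succ_iff.1 (κ j).2
    _ = m * p := by simp [mul_comm]

theorem binaryForm_pow (d : Fin (m + 1) → ℂ) (x y : ℂ) :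
    binaryForm m d x y ^ p
      = ∑ K ∈ Finset.range (m * p + 1), powCoeff m p d K * (x ^ K * y ^ (m * p - K)) := by
  rw [binaryForm, Fintype.sum_pow]
  rw [← Finset.sum_fiberwise_of_maps_to (s := Finset.univ) (t := Finset.range (m * p + 1))
    (g := fun κ : Fin p → Fin (m + 1) => ∑ j, (κ j : ℕ))
    fun κ _ => Finset.mem_range.2 (Nat.lt_succ_of_le (sum_tuple_le κ))]
  refine Finset.sum_congr rfl fun K _ => ?_
  rw [powCoeff, Finset.sum_mul]
  refine Finset.sum_congr rfl fun κ hκ => ?_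
  have hK : ∑ j, (κ j : ℕ) = K := (Finset.mem_filter.1 hκ).2
  have hK' : ∑ j, (m - (κ j : ℕ)) = m * p - K := by
    rw [Finset.sum_tsub_distrib _ fun j _ => Nat.lt_succ_iff.1 (κ j).2, hK]
    simp [mul_comm]
  rw [Finset.prod_mul_distrib, Finset.prod_mul_distrib, Finset.prod_mul_distrib,
    Finset.prod_pow_eq_pow_sum, Finset.prod_pow_eq_pow_sum, hK, hK', tupleWeight,
    Complex.ofReal_prod]
  ring

/-- A binary form is bounded by the Bombieri norm of its powers. -/
theorem norm_binaryForm_pow_le (d : Fin (m + 1) → ℂ) (x y : ℂ) (h : ‖x‖ ^ 2 + ‖y‖ ^ 2 = 1) :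
    (‖binaryForm m d x y‖ ^ 2) ^ p ≤ powBombieri m p d := by
  -- The Cauchy–Schwarz factor dual to the Bombieri norm is (‖x‖² + ‖y‖²)^(mp) = 1.
  have h1 : ∑ K ∈ Finset.range (m * p + 1),
      (‖x‖ ^ K * ‖y‖ ^ (m * p - K)) ^ 2 * ((m * p).choose K : ℝ) = 1 := by
    have h2 := add_pow (‖x‖ ^ 2) (‖y‖ ^ 2) (m * p)
    rw [h, one_pow] at h2
    rw [h2]
    refine Finset.sum_congr rfl fun K _ => ?_
    ring
  rw [← pow_mul, mul_comm 2 p, pow_mul, ← norm_pow, binaryForm_pow]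
  calc _ ≤ (∑ K ∈ Finset.range (m * p + 1),
          ‖powCoeff m p d K‖ * (‖x‖ ^ K * ‖y‖ ^ (m * p - K))) ^ 2 := by
        gcongr
        refine (norm_sum_le _ _).trans_eq ?_
        simp
    _ ≤ powBombieri m p d * ∑ K ∈ Finset.range (m * p + 1),
          (‖x‖ ^ K * ‖y‖ ^ (m * p - K)) ^ 2 * ((m * p).choose K : ℝ) := by
        refine Finset.sum_sq_le_sum_mul_sum_of_sq_le_mul _ (fun K _ => by positivity)
          (fun K _ => by positivity) fun K hK => Eq.le ?_
        have : ((m * p).choose K : ℝ) ≠ 0 := by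
          exact_mod_cast (Nat.choose_pos (Nat.lt_succ_iff.1 (Finset.mem_range.1 hK))).ne'
        field_simp
    _ = _ := by rw [h1, mul_one]

/-- Vandermonde's identity: compare the coefficients of X^K in ((1 + X)^m)^p = (1 + X)^(mp). -/
theorem sum_tupleWeight_sq (K : ℕ) :
    ∑ κ ∈ exponentTuples m p K, tupleWeight κ ^ 2 = ((m * p).choose K : ℝ) := by
  have h : ∀ κ : Fin p → Fin (m + 1), tupleWeight κ ^ 2 = ∏ j, (m.choose (κ j) : ℝ) := fun κ => by
    rw [tupleWeight, ← Finset.prod_pow]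
    exact Finset.prod_congr rfl fun j _ => Real.sq_sqrt (Nat.cast_nonneg _)
  simp_rw [h]
  have h2 : ((1 + Polynomial.X : Polynomial ℝ) ^ m) ^ p
      = ∑ κ : Fin p → Fin (m + 1),
        Polynomial.C (∏ j, (m.choose (κ j) : ℝ)) * Polynomial.X ^ (∑ j, (κ j : ℕ)) := by
    rw [add_comm, add_pow, Finset.sum_range, Fintype.sum_pow]
    refine Finset.sum_congr rfl fun κ _ => ?_
    rw [map_prod, ← Finset.prod_pow_eq_pow_sum, ← Finset.prod_mul_distrib]
    refine Finset.prod_congr rfl fun j _ => ?_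
    simp [mul_comm]
  have h3 := congrArg (fun q => Polynomial.coeff q K) h2
  simp only [← pow_mul, Polynomial.coeff_one_add_X_pow, Polynomial.finsetSum_coeff,
    Polynomial.coeff_C_mul, Polynomial.coeff_X_pow] at h3
  rw [h3, exponentTuples, Finset.sum_filter]
  refine Finset.sum_congr rfl fun κ _ => ?_
  simp [eq_comm]

theorem tupleWeight_comp (κ : Fin p → Fin (m + 1)) (σ : Equiv.Perm (Fin p)) :
    tupleWeight (κ ∘ σ) = tupleWeight κ :=
  Equiv.prod_comp σ fun j => binomWeight m (κ j)

theorem comp_mem_exponentTuples {K : ℕ} {κ : Fin p → Fin (m + 1)} (h : κ ∈ exponentTuples m p K)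
    (σ : Equiv.Perm (Fin p)) : κ ∘ σ ∈ exponentTuples m p K := by
  simp only [exponentTuples, Finset.mem_filter, Finset.mem_univ, true_and] at h ⊢
  rw [← h]
  exact Equiv.sum_comp σ fun j => (κ j : ℕ)

/-- Each of the p! permutations σ contributes to the single tuple κ' = κ ∘ σ, which has the same
weight as κ. -/
theorem sum_tupleWeight_mul_card {K : ℕ} {κ : Fin p → Fin (m + 1)}
    (h : κ ∈ exponentTuples m p K) :
    ∑ κ' ∈ exponentTuples m p K, tupleWeight κ' *
      ((Finset.univ.filter fun σ : Equiv.Perm (Fin p) => κ ∘ σ = κ').card : ℝ)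
      = p.factorial * tupleWeight κ := by
  simp_rw [Finset.card_filter, Nat.cast_sum, Finset.mul_sum]
  rw [Finset.sum_comm]
  have h1 : ∀ σ : Equiv.Perm (Fin p), ∑ κ' ∈ exponentTuples m p K,
      tupleWeight κ' * ((if κ ∘ σ = κ' then 1 else 0 : ℕ) : ℝ) = tupleWeight κ := fun σ => by
    rw [Finset.sum_eq_single_of_mem _ (comp_mem_exponentTuples m p h σ)]
    · simp [tupleWeight_comp]
    · intro κ' _ hne
      simp [hne.symm]
  simp_rw [h1]
  simp [Fintype.card_perm]

theorem integrable_and_integral_of_complex {α : Type*} [MeasurableSpace α] {μ : Measure α}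
    {f : α → ℝ} {g : α → ℂ} {c : ℝ} (h : ∀ x, (f x : ℂ) = g x) (hg : Integrable g μ)
    (hc : ∫ x, g x ∂μ = c) : Integrable f μ ∧ ∫ x, f x ∂μ = c := by
  constructor
  · have := hg.re
    simpa [← h] using this
  · simp_rw [← h, integral_complex_ofReal] at hc
    exact_mod_cast hc

/-- By Wick's formula and Vandermonde's identity, the binomial denominator cancels and each of the
mp + 1 coefficients contributes exactly p!. -/
theorem powBombieri_moment :
    (Integrable fun d : Fin (m + 1) → ℂ => powBombieri m p d * gaussianDensity d) ∧
    ∫ d : Fin (m + 1) → ℂ, powBombieri m p d * gaussianDensity d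
      = p.factorial * (m * p + 1) := by
  have hint : ∀ (c : ℂ) (κ κ' : Fin p → Fin (m + 1)), Integrable fun d : Fin (m + 1) → ℂ =>
      c * ((∏ j, d (κ j)) * (∏ j, starRingEnd ℂ (d (κ' j))) * (gaussianDensity d : ℂ)) :=
    fun c κ κ' => (integrable_monomial_gaussian κ κ').const_mul c
  refine integrable_and_integral_of_complex (g := fun d =>
    ∑ K ∈ Finset.range (m * p + 1), ∑ κ ∈ exponentTuples m p K, ∑ κ' ∈ exponentTuples m p K,
      (tupleWeight κ * tupleWeight κ' / ((m * p).choose K : ℝ) : ℝ) *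
      ((∏ j, d (κ j)) * (∏ j, starRingEnd ℂ (d (κ' j))) * (gaussianDensity d : ℂ)))
    (fun d => ?_) ?_ ?_
  · rw [powBombieri, Complex.ofReal_mul, Complex.ofReal_sum, Finset.sum_mul]
    refine Finset.sum_congr rfl fun K _ => ?_
    rw [Complex.ofReal_div, Complex.ofReal_pow, ← Complex.mul_conj', powCoeff, map_sum,
      Finset.sum_mul_sum, Finset.sum_div, Finset.sum_mul]
    refine Finset.sum_congr rfl fun κ _ => ?_
    rw [Finset.sum_div, Finset.sum_mul]
    refine Finset.sum_congr rfl fun κ' _ => ?_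
    simp only [map_mul, map_prod, Complex.conj_ofReal]
    push_cast
    ring
  · exact integrable_finsetSum _ fun K _ => integrable_finsetSum _ fun κ _ =>
      integrable_finsetSum _ fun κ' _ => hint _ κ κ'
  · rw [integral_finsetSum _ fun K _ => integrable_finsetSum _ fun κ _ =>
      integrable_finsetSum _ fun κ' _ => hint _ κ κ']
    have h1 : ∀ K ∈ Finset.range (m * p + 1), ∫ d : Fin (m + 1) → ℂ,
        ∑ κ ∈ exponentTuples m p K, ∑ κ' ∈ exponentTuples m p K,
          (tupleWeight κ * tupleWeight κ' / ((m * p).choose K : ℝ) : ℝ) *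
          ((∏ j, d (κ j)) * (∏ j, starRingEnd ℂ (d (κ' j))) * (gaussianDensity d : ℂ))
        = ((p.factorial : ℝ) : ℂ) := fun K hK => by
      rw [integral_finsetSum _ fun κ _ => integrable_finsetSum _ fun κ' _ => hint _ κ κ']
      simp_rw [integral_finsetSum _ fun κ' _ => hint _ _ κ', integral_const_mul,
        integral_monomial_gaussian]
      have h0 : ((m * p).choose K : ℝ) ≠ 0 := by
        exact_mod_cast (Nat.choose_pos (Nat.lt_succ_iff.1 (Finset.mem_range.1 hK))).ne'
      have h2 : ∑ κ ∈ exponentTuples m p K, ∑ κ' ∈ exponentTuples m p K,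
          (tupleWeight κ * tupleWeight κ' / ((m * p).choose K : ℝ)) *
          ((Finset.univ.filter fun σ : Equiv.Perm (Fin p) => κ ∘ σ = κ').card : ℝ)
          = p.factorial := by
        calc _ = ∑ κ ∈ exponentTuples m p K, tupleWeight κ / ((m * p).choose K : ℝ) *
              ∑ κ' ∈ exponentTuples m p K, tupleWeight κ' *
              ((Finset.univ.filter fun σ : Equiv.Perm (Fin p) => κ ∘ σ = κ').card : ℝ) := by
              refine Finset.sum_congr rfl fun κ _ => ?_
              rw [Finset.mul_sum]
              exact Finset.sum_congr rfl fun κ' _ => by ring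
          _ = ∑ κ ∈ exponentTuples m p K,
              (p.factorial / ((m * p).choose K : ℝ)) * tupleWeight κ ^ 2 := by
              refine Finset.sum_congr rfl fun κ hκ => ?_
              rw [sum_tupleWeight_mul_card m p hκ]
              ring
          _ = _ := by
              rw [← Finset.mul_sum, sum_tupleWeight_sq]
              field_simp
      rw [← h2]
      push_cast
      rfl
    rw [Finset.sum_congr rfl h1]
    simp
    ring

theorem norm_pow_moment :
    (Integrable fun d : Fin (m + 1) → ℂ => (∑ k, ‖d k‖ ^ 2) ^ p * gaussianDensity d) ∧
    ∫ d : Fin (m + 1) → ℂ, (∑ k, ‖d k‖ ^ 2) ^ p * gaussianDensity d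
      = ((m + 1).ascFactorial p : ℕ) := by
  refine integrable_and_integral_of_complex (g := fun d =>
    ∑ κ : Fin p → Fin (m + 1),
      (∏ j, d (κ j)) * (∏ j, starRingEnd ℂ (d (κ j))) * (gaussianDensity d : ℂ))
    (fun d => ?_) (integrable_finsetSum _ fun κ _ => integrable_monomial_gaussian κ κ) ?_
  · rw [Fintype.sum_pow, Complex.ofReal_mul, Complex.ofReal_sum, Finset.sum_mul]
    refine Finset.sum_congr rfl fun κ _ => ?_
    rw [← Finset.prod_mul_distrib, Complex.ofReal_prod]
    simp_rw [Complex.mul_conj']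
    push_cast
    rfl
  · rw [integral_finsetSum _ fun κ _ => integrable_monomial_gaussian κ κ]
    simp_rw [integral_monomial_gaussian]
    rw [← Nat.cast_sum, sum_card_stabilizer]
    simp

theorem gaussianDensity_pos {ι : Type*} [Fintype ι] (d : ι → ℂ) : 0 < gaussianDensity d :=
  Finset.prod_pos fun _ _ => by positivity

/-- Both sides have the same Gaussian mean, so the opposite strict inequality cannot hold at every d
≠ 0, that is, almost everywhere. -/
theorem exists_powBombieri_le :
    ∃ d : Fin (m + 1) → ℂ, d ≠ 0 ∧ powBombieri m p d * ((m + 1).ascFactorial p : ℕ)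
      ≤ p.factorial * (m * p + 1) * (∑ k, ‖d k‖ ^ 2) ^ p := by
  by_contra! hcon
  obtain ⟨i1, e1⟩ := powBombieri_moment m p
  obtain ⟨i2, e2⟩ := norm_pow_moment m p
  set a : ℝ := (((m + 1).ascFactorial p : ℕ) : ℝ)
  set c : ℝ := p.factorial * (m * p + 1)
  set g : (Fin (m + 1) → ℂ) → ℝ := fun d => a * (powBombieri m p d * gaussianDensity d)
    - c * ((∑ k, ‖d k‖ ^ 2) ^ p * gaussianDensity d) with hg
  have hgi : Integrable g := (i1.const_mul a).sub (i2.const_mul c)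
  have hg0 : ∫ d, g d = 0 := by
    rw [hg, integral_sub (i1.const_mul a) (i2.const_mul c), integral_const_mul,
      integral_const_mul, e1, e2]
    ring
  have hpos : ∀ᵐ d, 0 < g d := by
    have hne : ∀ᵐ d : Fin (m + 1) → ℂ, d ≠ 0 := compl_mem_ae_iff.2 (measure_singleton 0)
    filter_upwards [hne] with d hd
    have h1 := mul_pos (sub_pos.2 (hcon d hd)) (gaussianDensity_pos d)
    rw [hg]
    calc _ < _ := h1
      _ = _ := by ring
  have hz := (integral_eq_zero_iff_of_nonneg_ae (hpos.mono fun d hd => hd.le) hgi).1 hg0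
  obtain ⟨d, h1, h2⟩ := (hpos.and hz).exists
  simp [h2] at h1

theorem binaryForm_smul (t : ℂ) (d : Fin (m + 1) → ℂ) (x y : ℂ) :
    binaryForm m (t • d) x y = t * binaryForm m d x y := by
  simp only [binaryForm, Finset.mul_sum, Pi.smul_apply, smul_eq_mul, mul_assoc]

/-- There is a binary form of Bombieri norm one that is small on the unit sphere. -/
theorem exists_binaryForm_bound :
    ∃ d : Fin (m + 1) → ℂ, ∑ k, ‖d k‖ ^ 2 = 1 ∧ ∀ x y : ℂ, ‖x‖ ^ 2 + ‖y‖ ^ 2 = 1 →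
      (‖binaryForm m d x y‖ ^ 2) ^ p * ((m + 1).ascFactorial p : ℕ)
        ≤ p.factorial * (m * p + 1) := by
  obtain ⟨d, hd, hle⟩ := exists_powBombieri_le m p
  have hN : 0 < ∑ k, ‖d k‖ ^ 2 := by
    obtain ⟨k, hk⟩ := Function.ne_iff.1 hd
    exact Finset.sum_pos' (fun _ _ => by positivity)
      ⟨k, Finset.mem_univ k, pow_pos (norm_pos_iff.2 hk) 2⟩
  set N := ∑ k, ‖d k‖ ^ 2 with hNdef
  have ht : ‖(((√N)⁻¹ : ℝ) : ℂ)‖ ^ 2 = N⁻¹ := by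
    rw [Complex.norm_real, Real.norm_eq_abs, sq_abs, inv_pow, Real.sq_sqrt hN.le]
  refine ⟨(((√N)⁻¹ : ℝ) : ℂ) • d, ?_, fun x y hxy => ?_⟩
  · simp only [Pi.smul_apply, smul_eq_mul, norm_mul, mul_pow, ht]
    rw [← Finset.mul_sum, ← hNdef, inv_mul_cancel₀ hN.ne']
  · rw [binaryForm_smul, norm_mul, mul_pow, ht, mul_pow, inv_pow, mul_assoc,
      inv_mul_le_iff₀ (by positivity)]
    calc _ ≤ powBombieri m p d * ((m + 1).ascFactorial p : ℕ) := by
          gcongr; exact norm_binaryForm_pow_le m p d x y hxy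
      _ ≤ _ := hle
      _ = _ := by ring

end Moment

end GaussianAverage

/-! ### From binary forms to symmetric tensors -/

namespace SymEntanglement

/-- The number of factors `e₁` in a basis tensor. -/
def basisWeight {m : ℕ} (i : Fin m → Fin 2) : Fin (m + 1) :=
  ⟨(Finset.univ.filter fun j => i j = 1).card,
    Nat.lt_succ_of_le ((Finset.card_le_univ _).trans_eq (Fintype.card_fin m))⟩

theorem sum_basisWeight {m : ℕ} {M : Type*} [AddCommMonoid M] (g : Fin (m + 1) → M) :
    ∑ i : Fin m → Fin 2, g (basisWeight i) = ∑ k : Fin (m + 1), m.choose k • g k := by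
  have h := Finset.sum_powerset_apply_card
    (f := fun k => if h : k < m + 1 then g ⟨k, h⟩ else 0) (x := (Finset.univ : Finset (Fin m)))
  rw [Finset.card_univ, Fintype.card_fin, Finset.sum_range] at h
  simp only [Fin.is_lt, dif_pos] at h
  rw [← h]
  refine Finset.sum_nbij' (fun i => Finset.univ.filter fun j => i j = 1)
    (fun A j => if j ∈ A then 1 else 0) (by simp) (by simp) ?_ ?_ ?_
  · intro i _
    ext j
    have : i j = 0 ∨ i j = 1 := by omega
    rcases this with h | h <;> simp [h]
  · intro A _
    ext j
    simp
  · intro i _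
    have h1 : (Finset.univ.filter fun j => i j = 1).card < m + 1 := (basisWeight i).2
    simp only [dif_pos h1]
    rfl

theorem basisWeight_comp {m : ℕ} (i : Fin m → Fin 2) (σ : Equiv.Perm (Fin m)) :
    basisWeight (i ∘ σ) = basisWeight i := by
  simp only [basisWeight, Fin.mk.injEq]
  exact Finset.card_equiv σ fun j => by simp

/-- The symmetric tensor with coefficients `conj d` in the orthonormal basis of Dicke states. -/
noncomputable def dickeTensor {m : ℕ} (d : Fin (m + 1) → ℂ) : Tensors 2 m :=
  WithLp.toLp 2 fun i =>
    starRingEnd ℂ (d (basisWeight i)) * ((binomWeight m (basisWeight i))⁻¹ : ℝ)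

theorem permute_dickeTensor {m : ℕ} (d : Fin (m + 1) → ℂ) (σ : Equiv.Perm (Fin m)) :
    permute σ (dickeTensor d) = dickeTensor d := by
  ext i
  simp [permute, dickeTensor, basisWeight_comp]

theorem binomWeight_sq {m : ℕ} (k : Fin (m + 1)) : binomWeight m k ^ 2 = m.choose k :=
  Real.sq_sqrt (Nat.cast_nonneg _)

theorem binomWeight_pos {m : ℕ} (k : Fin (m + 1)) : 0 < binomWeight m k :=
  Real.sqrt_pos.2 (by exact_mod_cast Nat.choose_pos (Nat.lt_succ_iff.1 k.2))

theorem norm_dickeTensor_sq {m : ℕ} (d : Fin (m + 1) → ℂ) :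
    ‖dickeTensor d‖ ^ 2 = ∑ k, ‖d k‖ ^ 2 := by
  rw [EuclideanSpace.norm_sq_eq]
  simp only [dickeTensor, norm_mul, RCLike.norm_conj, Complex.norm_real, Real.norm_eq_abs, mul_pow,
    sq_abs]
  rw [sum_basisWeight fun k => ‖d k‖ ^ 2 * (binomWeight m k)⁻¹ ^ 2]
  refine Finset.sum_congr rfl fun k _ => ?_
  have := (binomWeight_pos k).ne'
  rw [nsmul_eq_mul, ← binomWeight_sq]
  field_simp

/-- The inner product is conjugate-linear in its first argument, which undoes the conjugation in
`dickeTensor`. The `m.choose k` basis tensors of weight k, each with coefficient 1/√(m choose k),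
together give the Bombieri weight √(m choose k). -/
theorem inner_dickeTensor {m : ℕ} (d : Fin (m + 1) → ℂ) (v : EuclideanSpace ℂ (Fin 2)) :
    inner ℂ (dickeTensor d) (tprod fun _ => v) = binaryForm m d (v 1) (v 0) := by
  have h : ∀ i : Fin m → Fin 2, ∏ j, v (i j)
      = v 1 ^ (basisWeight i : ℕ) * v 0 ^ (m - basisWeight i) := fun i => by
    rw [← Finset.prod_filter_mul_prod_filter_not Finset.univ fun j => i j = 1]
    congr 1
    · rw [Finset.prod_congr rfl fun j hj => by rw [(Finset.mem_filter.1 hj).2], Finset.prod_const]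
      rfl
    · have h0 : ∀ j ∈ Finset.univ.filter fun j => ¬ i j = 1, v (i j) = v 0 := fun j hj => by
        have := (Finset.mem_filter.1 hj).2
        rw [show i j = 0 by omega]
      rw [Finset.prod_congr rfl h0, Finset.prod_const]
      congr 1
      have := Finset.card_filter_add_card_filter_not (s := Finset.univ) fun j => i j = 1
      rw [Finset.card_univ, Fintype.card_fin] at this
      simp only [basisWeight]
      omega
  simp only [PiLp.inner_apply, tprod, dickeTensor, RCLike.inner_apply, map_mul, RCLike.conj_conj,
    Complex.conj_ofReal, h]
  rw [sum_basisWeight fun k => v 1 ^ (k : ℕ) * v 0 ^ (m - k) *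
    (d k * ((binomWeight m k)⁻¹ : ℝ)), binaryForm]
  refine Finset.sum_congr rfl fun k _ => ?_
  have h1 : (binomWeight m k : ℂ) ≠ 0 := by exact_mod_cast (binomWeight_pos k).ne'
  have h2 : (m.choose k : ℂ) = (binomWeight m k : ℂ) ^ 2 := by
    exact_mod_cast (binomWeight_sq k).symm
  rw [nsmul_eq_mul, h2]
  push_cast
  field_simp

/-- The moment bound for the smallest spectral norm of a symmetric unit tensor. -/
theorem exists_unitSym_specNorm_sq_le {m : ℕ} (hm : 1 ≤ m) {p : ℕ} (hp : 1 ≤ p) {B : ℝ}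
    (hB : 0 ≤ B)
    (h : (p.factorial : ℝ) * (m * p + 1) ≤ B ^ p * ((m + 1).ascFactorial p : ℕ)) :
    ∃ T ∈ unitSym 2 m, specNorm T ^ 2 ≤ B := by
  obtain ⟨d, hd1, hd⟩ := exists_binaryForm_bound m p
  have hT : ‖dickeTensor d‖ = 1 := by
    rw [← pow_eq_one_iff_of_nonneg (norm_nonneg _) two_ne_zero, norm_dickeTensor_sq, hd1]
  refine ⟨dickeTensor d, ⟨permute_dickeTensor d, hT⟩, ?_⟩
  rw [← Real.le_sqrt (specNorm_nonneg _) hB]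
  refine specNorm_le_of_symm hm (permute_dickeTensor d) (Real.sqrt_nonneg _) fun x hx => ?_
  rw [inner_dickeTensor, Real.le_sqrt (norm_nonneg _) hB]
  have hx1 : ‖x 1‖ ^ 2 + ‖x 0‖ ^ 2 = 1 := by
    have := EuclideanSpace.norm_sq_eq x
    rw [hx, Fin.sum_univ_two] at this
    linarith
  have hpos : (0 : ℝ) < ((m + 1).ascFactorial p : ℕ) := by
    exact_mod_cast Nat.ascFactorial_pos m p
  exact le_of_pow_le_pow_left₀ (by omega) hB
    (le_of_mul_le_mul_right ((hd _ _ hx1).trans h) hpos)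

theorem exists_unitSym_specNorm_sq_le_log {m : ℕ} (hm : 1 ≤ m) :
    ∃ T ∈ unitSym 2 m,
      specNorm T ^ 2 ≤ (1 + Real.log (4 * (m : ℝ) * √(m : ℝ))) / m := by
  have hm0 : (0 : ℝ) < m := by exact_mod_cast hm
  by_cases hm5 : 5 ≤ m
  · obtain ⟨p, hp, hle⟩ := exists_moment_bound hm5
    have hL : 0 ≤ Real.log (4 * (m : ℝ) * √(m : ℝ)) := by
      have h1 : (1 : ℝ) ≤ m := by exact_mod_cast hm
      have h2 : 1 ≤ √(m : ℝ) := Real.one_le_sqrt.2 h1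
      exact Real.log_nonneg (by nlinarith)
    refine exists_unitSym_specNorm_sq_le hm hp (by positivity) ?_
    rw [div_pow, div_mul_eq_mul_div, le_div_iff₀ (by positivity)]
    exact hle
  -- For m ≤ 4 the right side is at least 1, so any symmetric unit tensor will do.
  · obtain ⟨T, hT⟩ := unitSym_nonempty (n := 2) (by norm_num) m
    refine ⟨T, hT, ?_⟩
    have h1 := specNorm_le_norm T
    rw [hT.2] at h1
    have h2 := le_one_add_log_of_le_four hm (by omega)
    calc specNorm T ^ 2 ≤ 1 := pow_le_one₀ (specNorm_nonneg T) h1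
      _ ≤ _ := by rwa [le_div_iff₀ hm0, one_mul]

end SymEntanglement

/-- The first conjunct says that the supremum defining `maxSymEntanglement` is a maximum. -/
theorem corollary1p10 (m : ℕ) (hm : 1 ≤ m) :
    IsGreatest (SymEntanglement.entanglement '' SymEntanglement.unitSym 2 m)
      (SymEntanglement.maxSymEntanglement 2 m) ∧
    SymEntanglement.maxSymEntanglement 2 m ≥
      Real.logb 2 (m : ℝ) - Real.logb 2 (1 + Real.log (4 * (m : ℝ) * Real.sqrt (m : ℝ))) := by
  have hmax := SymEntanglement.isGreatest_maxSymEntanglement (n := 2) (by norm_num) m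
  refine ⟨hmax, ?_⟩
  obtain ⟨T, hT, hle⟩ := SymEntanglement.exists_unitSym_specNorm_sq_le_log hm
  refine le_trans ?_ (hmax.2 ⟨T, hT, rfl⟩)
  have hm0 : (0 : ℝ) < m := by exact_mod_cast hm
  have hpos : 0 < SymEntanglement.specNorm T := SymEntanglement.specNorm_pos (by
    rintro rfl
    simpa using hT.2)
  have hB := lt_of_lt_of_le (pow_pos hpos 2) hle
  have hL : 0 < 1 + Real.log (4 * (m : ℝ) * √(m : ℝ)) := by
    rwa [div_pos_iff_of_pos_right hm0] at hB
  have h := Real.logb_le_logb_of_le (b := 2) (by norm_num) (pow_pos hpos 2) hle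
  rw [Real.logb_div hL.ne' hm0.ne', Real.logb_pow] at h
  rw [SymEntanglement.entanglement]
  push_cast at h
  linarith
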